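/- All digraphs are finite, without loops and multiple arcs. For a digraph $D$ write $d(v)=d^+(v)+d^-(v)$ for the sum of the out-degree and the in-degree of $v$; two distinct vertices $u,v$ are non-adjacent if neither $uv$ nor $vu$ is an arc. A balanced bipartite digraph of order $2a$ is one whose vertex set is the disjoint union of two independent sets of $a$ vertices each; $D$ is strong if for all vertices $x,y$ there is a directed path from $x$ to $y$; $D$ is traceable if it has a hamiltonian path, i.e. a directed path through all vertices. (i) Let $a\ge 3$ and let $D$ be a strong balanced bipartite digraph of order $2a$. If $d(u)+d(v)\ge 3a-1$ for all pairs of non-adjacent vertices $u,v$ of $D$, then $D$ is traceable. (ii) The bound $3a-1$ is sharp: let $a\ge 4$ be even and let $H_3$ be the digraph with partite sets $V_1=S\sqcup R$ and $V_2=U\sqcup W$, where $|S|=|W|=\frac{a+2}{2}$ and $|U|=|R|=\frac{a-2}{2}$, whose arcs are exactly: $ry$ and $yr$ for all $r\in R$, $y\in V_2$; $ux$ and $xu$ for all $u\in U$, $x\in V_1$; and $ws$ for all $w\in W$, $s\in S$. Then $H_3$ is a strong balanced bipartite digraph of order $2a$ with $d(u)+d(v)\ge 3a-2$ for all pairs of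 non-adjacent vertices $u,v$, and $H_3$ is not traceable. -/

import Mathlib

namespace Digraph

/-- The out-degree of `v`: the number of vertices dominated by `v`. -/
noncomputable def outDeg {V : Type*} (D : Digraph V) (v : V) : ℕ :=
  {u : V | D.Adj v u}.ncard

/-- The in-degree of `v`: the number of vertices dominating `v`. -/
noncomputable def inDeg {V : Type*} (D : Digraph V) (v : V) : ℕ :=
  {u : V | D.Adj u v}.ncard

/-- The degree `d(v) = d⁺(v) + d⁻(v)`. -/
noncomputable def deg {V : Type*} (D : Digraph V) (v : V) : ℕ :=
  D.outDeg v + D.inDeg v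

/-- A set of vertices is independent if no arc (in particular no loop) has both ends in it. -/
def IsIndependent {V : Type*} (D : Digraph V) (X : Set V) : Prop :=
  ∀ x ∈ X, ∀ y ∈ X, ¬ D.Adj x y

/-- `D` is a balanced bipartite digraph of order `2a`: its vertex set is the disjoint union
of two independent sets of `a` vertices each.  In particular `D` has no loops. -/
def IsBalancedBipartite {V : Type*} (D : Digraph V) (a : ℕ) : Prop :=
  ∃ V₁ V₂ : Set V, Disjoint V₁ V₂ ∧ V₁ ∪ V₂ = Set.univ ∧
    D.IsIndependent V₁ ∧ D.IsIndependent V₂ ∧ V₁.ncard = a ∧ V₂.ncard = a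

/-- `D` is strong: from every vertex one can reach every vertex along arcs of `D`. -/
def IsStrong {V : Type*} (D : Digraph V) : Prop :=
  ∀ x y : V, Relation.ReflTransGen D.Adj x y

/-- The Meyniel-type condition `M_k` for digraphs of order `2a`: `d(u) + d(v) ≥ 3a + k` for
every pair of distinct non-adjacent vertices `u`, `v` (neither `uv` nor `vu` is an arc). -/
def MeynielCondition {V : Type*} (D : Digraph V) (a : ℕ) (k : ℤ) : Prop :=
  ∀ u v : V, u ≠ v → ¬ D.Adj u v → ¬ D.Adj v u →
    3 * (a : ℤ) + k ≤ (D.deg u : ℤ) + (D.deg v : ℤ)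

/-- A hamiltonian path, as the list of its vertices in order: consecutive vertices are joined
by arcs directed forwards, no vertex is repeated, and every vertex occurs. -/
def IsHamiltonianPath {V : Type*} (D : Digraph V) (p : List V) : Prop :=
  p.IsChain D.Adj ∧ p.Nodup ∧ ∀ v : V, v ∈ p

/-- `D` is traceable if it has a hamiltonian path. -/
def IsTraceable {V : Type*} (D : Digraph V) : Prop :=
  ∃ p : List V, D.IsHamiltonianPath p

/-- The vertices of `H₃`: the partite sets are `V₁ = S ⊔ R` and `V₂ = U ⊔ W`, where
`|S| = |W| = (a + 2) / 2` and `|R| = |U| = (a - 2) / 2`.  (Used only for even `a ≥ 4`.) -/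
inductive H3Vertex (a : ℕ) : Type
  | S (i : Fin ((a + 2) / 2))
  | R (i : Fin ((a - 2) / 2))
  | U (i : Fin ((a - 2) / 2))
  | W (i : Fin ((a + 2) / 2))

/-- The arcs of `H₃`. -/
inductive H3Arc (a : ℕ) : H3Vertex a → H3Vertex a → Prop
  | ru (r u) : H3Arc a (.R r) (.U u)
  | ur (r u) : H3Arc a (.U u) (.R r)
  | rw (r w) : H3Arc a (.R r) (.W w)
  | wr (r w) : H3Arc a (.W w) (.R r)
  | us (u s) : H3Arc a (.U u) (.S s)
  | su (u s) : H3Arc a (.S s) (.U u)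
  | ws (w s) : H3Arc a (.W w) (.S s)

/-- The digraph `H₃` for the parameter `a`: all arcs in both directions between `R` and
`V₂ = U ⊔ W`, all arcs in both directions between `U` and `V₁ = S ⊔ R`, and all arcs from
`W` to `S`. -/
def H3 (a : ℕ) : Digraph (H3Vertex a) where
  Adj := H3Arc a

end Digraph

/-!
Let `D` be a strong balanced bipartite digraph of order `2a` satisfying the degree condition for
`3a - 1`.  By Hall's theorem either `D` has a cycle factor, encoded as a permutation `σ` with
`v → σ v` for all `v`, or some set `S` in one part has fewer than `#S` out-neighbours.  In the
second case the degree condition forces a rigid structure in which a hamiltonian path is visible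
(`isTraceable_of_hall_violator`).

In the first case `σ` is chosen so that no two of its cycles can be merged by exchanging two arcs:
if `u`, `v` lie on different cycles, then `u → σ v` and `v → σ u` do not both hold.  If `σ` has at
most two cycles, strongness provides an arc linking them and hence a hamiltonian path
(`IsCycleFactor.isTraceable_of_le_two`).  For three or more cycles, counting arcs gives
`d⁺(u) + d⁻(σ u) ≤ a + c(u)`, where `c(u)` is half the length of the cycle through `u`
(`outDeg_add_inDeg_apply_le`), while the degree condition, summed over two cycles with
half-lengths `c₁`, `c₂`, gives
`(c₁ + c₂)(3a - 1) ≤ 2c₁(a + c₁) + 2c₂(a + c₂)`.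
For the two shortest cycles this fails unless `a = 3` and there are three cycles of length two.
Then all the inequalities are tight, so for any two vertices `u ≠ v` of a part `u → σ v` or
`v → σ u`; a hamiltonian path of this tournament on three vertices lifts to one of `D`
(`IsCycleFactor.isTraceable`).

For the sharpness example `H₃`, a hamiltonian path would enter a vertex of `U` after every vertex
of `S` except possibly one, but `S` has two vertices more than `U`.
-/

open Finset

namespace Digraph

variable {V : Type*} {D : Digraph V} {A : Finset V} {σ : Equiv.Perm V} {a : ℕ}

/-- Every arc of `D` joins `A` to its complement, in one direction or the other. -/
def Crosses (D : Digraph V) (A : Finset V) : Prop :=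
  ∀ x y, D.Adj x y → (x ∈ A ↔ y ∉ A)

lemma Crosses.irrefl (hA : D.Crosses A) (x : V) : ¬ D.Adj x x := fun h => by
  have := hA x x h
  tauto

/-- `σ` maps every vertex along an arc of `D`; its orbits are then the cycles of a cycle factor. -/
def IsCycleFactor (D : Digraph V) (σ : Equiv.Perm V) : Prop := ∀ v, D.Adj v (σ v)

/-- No two cycles of the cycle factor `σ` can be merged by exchanging the arcs `x → σ x` and
`y → σ y` for `x → σ y` and `y → σ x`. -/
def IsUnmergeable (D : Digraph V) (σ : Equiv.Perm V) : Prop :=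
  ∀ x y, ¬ σ.SameCycle x y → D.Adj x (σ y) → ¬ D.Adj y (σ x)

lemma Crosses.apply_mem_iff (hA : D.Crosses A) (hσ : D.IsCycleFactor σ) (v : V) :
    σ v ∈ A ↔ v ∉ A := by
  have := hA v (σ v) (hσ v)
  tauto

/-! ### Merging cycles -/

/-- If `x` and `y` lie on different cycles of `σ`, composing with the transposition of `x` and `y`
joins these two cycles into one. -/
lemma sameCycle_mul_swap [Finite V] [DecidableEq V] {x y : V} (h : ¬ σ.SameCycle x y) :
    (σ * Equiv.swap x y).SameCycle x y := by
  set τ := σ * Equiv.swap x y with hτ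
  have key : ∀ n : ℕ, τ.SameCycle x ((σ ^ (n + 1)) y) ∨ τ.SameCycle x y := by
    intro n
    induction n with
    | zero =>
      left
      have : τ x = (σ ^ (0 + 1)) y := by simp [hτ]
      rw [← this]
      exact (Equiv.Perm.sameCycle_apply_right).2 (Equiv.Perm.SameCycle.refl _ _)
    | succ n ih =>
      rcases ih with ih | ih
      · by_cases hy : (σ ^ (n + 1)) y = y
        · right
          rwa [hy] at ih
        · left
          have hx : (σ ^ (n + 1)) y ≠ x := by
            intro hx
            exact h (Equiv.Perm.SameCycle.symm ⟨(n + 1 : ℕ), by exact_mod_cast hx⟩)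
          have : τ ((σ ^ (n + 1)) y) = (σ ^ (n + 1 + 1)) y := by
            simp only [hτ, Equiv.Perm.mul_apply]
            rw [Equiv.swap_apply_of_ne_of_ne hx hy, pow_succ' σ (n + 1)]
            rfl
          rw [← this]
          exact (Equiv.Perm.sameCycle_apply_right).2 ih
      · exact Or.inr ih
  have hpos : 0 < orderOf σ := orderOf_pos σ
  have := key (orderOf σ - 1)
  rw [Nat.sub_add_cancel hpos, pow_orderOf_eq_one] at this
  simpa using this

lemma sameCycle_mul_swap_of_sameCycle [Finite V] [DecidableEq V] {x y u v : V} (h : ¬ σ.SameCycle x y)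
    (huv : σ.SameCycle u v) : (σ * Equiv.swap x y).SameCycle u v := by
  have hxy := sameCycle_mul_swap h
  set τ := σ * Equiv.swap x y with hτ
  have step : ∀ w, τ.SameCycle w (σ w) := by
    intro w
    by_cases hwx : w = x
    · have : τ y = σ w := by simp [hτ, hwx]
      rw [← this, Equiv.Perm.sameCycle_apply_right, hwx]
      exact hxy
    · by_cases hwy : w = y
      · have : τ x = σ w := by simp [hτ, hwy]
        rw [← this, Equiv.Perm.sameCycle_apply_right, hwy]
        exact hxy.symm
      · have : τ w = σ w := by simp [hτ, Equiv.swap_apply_of_ne_of_ne hwx hwy]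
        rw [← this, Equiv.Perm.sameCycle_apply_right]
  obtain ⟨n, rfl⟩ := huv.exists_nat_pow_eq
  clear huv
  induction n with
  | zero => exact Equiv.Perm.SameCycle.refl _ _
  | succ n ih =>
    refine ih.trans ?_
    rw [pow_succ' σ n]
    exact step _

/-- A cycle factor with the largest number of pairs of vertices on a common cycle is
unmergeable. -/
lemma IsCycleFactor.exists_isUnmergeable [Finite V] (hσ : D.IsCycleFactor σ) :
    ∃ τ, D.IsCycleFactor τ ∧ D.IsUnmergeable τ := by
  classical
  cases nonempty_fintype V
  let f : Equiv.Perm V → ℕ := fun τ => #{p : V × V | τ.SameCycle p.1 p.2}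
  obtain ⟨τ, hτ, hmax⟩ := ({τ | D.IsCycleFactor τ} : Finset (Equiv.Perm V)).exists_max_image f
    ⟨σ, by simpa using hσ⟩
  simp only [mem_filter, mem_univ, true_and] at hτ hmax
  refine ⟨τ, hτ, fun x y hxy h₁ h₂ => ?_⟩
  have hfac : D.IsCycleFactor (τ * Equiv.swap x y) := by
    intro w
    by_cases hwx : w = x
    · simpa [hwx] using h₁
    · by_cases hwy : w = y
      · simpa [hwy] using h₂
      · simpa [Equiv.swap_apply_of_ne_of_ne hwx hwy] using hτ w
  refine absurd (hmax _ hfac) (not_le.2 (card_lt_card ?_))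
  rw [ssubset_iff_of_subset]
  · exact ⟨(x, y), by simpa using sameCycle_mul_swap hxy, by simpa using hxy⟩
  · intro p
    simpa using sameCycle_mul_swap_of_sameCycle hxy

/-! ### Cycle factors with at most two cycles -/

lemma IsCycleFactor.isChain_toList [Fintype V] [DecidableEq V] (hσ : D.IsCycleFactor σ) (x : V) :
    (σ.toList x).IsChain D.Adj := by
  rw [List.isChain_iff_getElem]
  intro i hi
  rw [Equiv.Perm.getElem_toList, Equiv.Perm.getElem_toList, pow_succ']
  exact hσ _

/-- A cycle factor of a strong digraph with at most two cycles yields a hamiltonian path: with two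
cycles, traverse the first one up to the tail of an arc leaving it, and then the second one. -/
lemma IsCycleFactor.isTraceable_of_le_two [Finite V] (hA : D.Crosses A) (hD : D.IsStrong)
    (hσ : D.IsCycleFactor σ) {x y : V} (h : ∀ z, σ.SameCycle x z ∨ σ.SameCycle y z) :
    D.IsTraceable := by
  classical
  cases nonempty_fintype V
  have hmem : ∀ v w, w ∈ σ.toList v ↔ σ.SameCycle v w := by
    intro v w
    rw [Equiv.Perm.mem_toList_iff, and_iff_left]
    rw [Equiv.Perm.mem_support]
    intro hv
    exact hA.irrefl v (by simpa [hv] using hσ v)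
  by_cases hxy : σ.SameCycle x y
  · refine ⟨σ.toList x, hσ.isChain_toList x, σ.nodup_toList x, fun v => ?_⟩
    rw [hmem]
    exact (h v).elim id hxy.trans
  · obtain ⟨p, q, hp, hq, hpq⟩ : ∃ p q, σ.SameCycle x p ∧ ¬ σ.SameCycle x q ∧ D.Adj p q := by
      by_contra! hcon
      have : ∀ z, Relation.ReflTransGen D.Adj x z → σ.SameCycle x z := by
        intro z hz
        induction hz with
        | refl => exact Equiv.Perm.SameCycle.refl _ _
        | tail _ hbc ih => exact by_contra fun hc => hcon _ _ ih hc hbc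
      exact hxy (this y (hD x y))
    have hyq : σ.SameCycle y q := (h q).resolve_left hq
    refine ⟨σ.toList (σ p) ++ σ.toList q, ?_, ?_, ?_⟩
    · rw [List.isChain_append]
      refine ⟨hσ.isChain_toList _, hσ.isChain_toList _, ?_⟩
      have hlast : ∀ u ∈ (σ.toList (σ p)).getLast?, u = p := by
        intro u hu
        obtain ⟨hne, rfl⟩ := List.mem_getLast?_eq_getLast hu
        rw [List.getLast_eq_getElem, Equiv.Perm.getElem_toList]
        have hpos : 0 < (σ.toList (σ p)).length := List.length_pos_iff.2 hne
        rw [← Equiv.Perm.mul_apply, ← pow_succ, Nat.sub_add_cancel hpos,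
          Equiv.Perm.length_toList, ← Equiv.Perm.pow_mod_card_support_cycleOf_self_apply]
        have : σ.cycleOf (σ p) = σ.cycleOf p :=
          (Equiv.Perm.SameCycle.cycleOf_eq
            (Equiv.Perm.sameCycle_apply_left.2 (Equiv.Perm.SameCycle.refl _ _)))
        rw [this, Nat.mod_self, pow_zero, Equiv.Perm.one_apply]
      have hhead : ∀ u ∈ (σ.toList q).head?, u = q := by
        intro u hu
        rw [List.head?_eq_getElem?, Option.mem_def, List.getElem?_eq_some_iff] at hu
        obtain ⟨h0, rfl⟩ := hu
        simp [Equiv.Perm.getElem_toList]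
      intro u hu v hv
      rw [hlast u hu, hhead v hv]
      exact hpq
    · refine List.Nodup.append (σ.nodup_toList _) (σ.nodup_toList _) ?_
      intro z hz hz'
      rw [hmem] at hz hz'
      exact hq (hp.trans ((Equiv.Perm.sameCycle_apply_left.1 hz).trans hz'.symm))
    · intro v
      rw [List.mem_append, hmem, hmem, Equiv.Perm.sameCycle_apply_left]
      exact (h v).imp hp.symm.trans hyq.symm.trans

/-! ### Degree sums over a cycle -/

lemma outDeg_eq_card [Fintype V] [DecidableRel D.Adj] (v : V) :
    D.outDeg v = #{u | D.Adj v u} := by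
  rw [outDeg, ← Set.ncard_coe_finset]
  simp

lemma inDeg_eq_card [Fintype V] [DecidableRel D.Adj] (v : V) :
    D.inDeg v = #{u | D.Adj u v} := by
  rw [inDeg, ← Set.ncard_coe_finset]
  simp

open Classical in
/-- The number of vertices of `A` on the cycle of `σ` through `x`.  For a cycle factor of a
digraph all of whose arcs cross `A`, this is half the length of that cycle. -/
noncomputable def halfLength [Fintype V] (A : Finset V) (σ : Equiv.Perm V) (x : V) : ℕ :=
  #{v ∈ A | σ.SameCycle x v}

open Classical in
lemma halfLength_compl [Fintype V] (hA : D.Crosses A) (hσ : D.IsCycleFactor σ) (x : V) :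
    halfLength Aᶜ σ x = halfLength A σ x := by
  unfold halfLength
  apply le_antisymm
  all_goals
    refine card_le_card_of_injOn σ ?_ σ.injective.injOn
    intro v hv
    have := hA.apply_mem_iff hσ v
    simp_all [Equiv.Perm.sameCycle_apply_right]

lemma halfLength_congr [Fintype V] {x y : V} (h : σ.SameCycle x y) :
    halfLength A σ x = halfLength A σ y := by
  classical
  unfold halfLength
  congr 1
  ext v
  simp only [mem_filter, and_congr_right_iff]
  exact fun _ => ⟨h.symm.trans, h.trans⟩

open Classical in
lemma card_cycle [Fintype V] (hA : D.Crosses A) (hσ : D.IsCycleFactor σ) (x : V) :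
    #{v | σ.SameCycle x v} = 2 * halfLength A σ x := by
  have h1 := halfLength_compl hA hσ x
  have h2 := card_filter_add_card_filter_not (s := ({v | σ.SameCycle x v} : Finset V))
    (fun v => v ∈ A)
  rw [filter_filter, filter_filter] at h2
  unfold halfLength at h1 ⊢
  have e1 : ({v | σ.SameCycle x v ∧ v ∈ A} : Finset V) = {v ∈ A | σ.SameCycle x v} := by
    ext; simp [and_comm]
  have e2 : ({v | σ.SameCycle x v ∧ v ∉ A} : Finset V) = {v ∈ Aᶜ | σ.SameCycle x v} := by
    ext; simp [and_comm]
  rw [e1, e2] at h2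
  omega

lemma halfLength_pos [Fintype V] (hA : D.Crosses A) (hσ : D.IsCycleFactor σ) (x : V) :
    0 < halfLength A σ x := by
  classical
  have := card_cycle hA hσ x
  have : 0 < #{v | σ.SameCycle x v} := card_pos.2 ⟨x, by simp [Equiv.Perm.SameCycle.refl]⟩
  omega

open Classical in
/-- Arcs from `u` and arcs into `σ u`, counted together: reindexing the former by `v ↦ σ v`, a
vertex `v` contributes only if it lies in the part of `u`, at most `1` if it lies on another cycle
than `u`, and at most `2` otherwise.  Strictness comes from a vertex contributing nothing. -/
lemma outDeg_add_inDeg_apply_le [Fintype V] (hA : D.Crosses A) (hσ : D.IsCycleFactor σ)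
    (hu : D.IsUnmergeable σ) (hcA : #A = a) (hcA' : #Aᶜ = a) (u : V) :
    D.outDeg u + D.inDeg (σ u) ≤ a + halfLength A σ u ∧
      ((∃ w, (w ∈ A ↔ u ∈ A) ∧ ¬ D.Adj u (σ w) ∧ ¬ D.Adj w (σ u)) →
        D.outDeg u + D.inDeg (σ u) < a + halfLength A σ u) := by
  have hout : D.outDeg u = ∑ v, if D.Adj u (σ v) then 1 else 0 := by
    rw [outDeg_eq_card, card_filter]
    exact (Equiv.sum_comp σ (fun w => if D.Adj u w then 1 else 0)).symm
  have hin : D.inDeg (σ u) = ∑ v, if D.Adj v (σ u) then 1 else 0 := by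
    rw [inDeg_eq_card, card_filter]
  have hbound : a + halfLength A σ u
      = ∑ v, ((if (v ∈ A ↔ u ∈ A) then 1 else 0) +
          (if (v ∈ A ↔ u ∈ A) ∧ σ.SameCycle u v then 1 else 0)) := by
    rw [sum_add_distrib, ← card_filter, ← card_filter]
    congr 1
    · by_cases h : u ∈ A
      · simpa [h] using hcA.symm
      · simp only [h, iff_false]
        rw [← hcA']
        congr 1
        ext; simp
    · by_cases h : u ∈ A
      · unfold halfLength
        congr 1
        ext; simp [h]
      · rw [← halfLength_compl hA hσ]
        unfold halfLength
        congr 1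
        ext; simp [h]
  rw [hout, hin, ← sum_add_distrib, hbound]
  have hterm : ∀ v ∈ (univ : Finset V),
      ((if D.Adj u (σ v) then 1 else 0) + if D.Adj v (σ u) then 1 else 0) ≤
        ((if (v ∈ A ↔ u ∈ A) then 1 else 0) +
          (if (v ∈ A ↔ u ∈ A) ∧ σ.SameCycle u v then 1 else 0)) := by
    intro v _
    have h1 := hA u (σ v)
    have h2 := hA v (σ u)
    have h3 := hA.apply_mem_iff hσ u
    have h4 := hA.apply_mem_iff hσ v
    have h5 := hu u v
    by_cases hp : (v ∈ A ↔ u ∈ A)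
    · by_cases hs : σ.SameCycle u v
      · rw [if_pos (c := v ∈ A ↔ u ∈ A) hp,
          if_pos (c := (v ∈ A ↔ u ∈ A) ∧ σ.SameCycle u v) ⟨hp, hs⟩]
        split_ifs <;> omega
      · rw [if_pos (c := v ∈ A ↔ u ∈ A) hp,
          if_neg (c := (v ∈ A ↔ u ∈ A) ∧ σ.SameCycle u v) (fun h => hs h.2)]
        have h6 := h5 hs
        split_ifs <;> first | omega | exact absurd ‹_› (h6 ‹_›)
    · have n1 : ¬ D.Adj u (σ v) := by tauto
      have n2 : ¬ D.Adj v (σ u) := by tauto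
      simp [n1, n2]
  refine ⟨sum_le_sum hterm, ?_⟩
  rintro ⟨w, hw, n1, n2⟩
  refine sum_lt_sum hterm ⟨w, mem_univ _, ?_⟩
  simp [n1, n2, hw]

open Classical in
/-- Summing `outDeg_add_inDeg_apply_le` over the cycle through `x`. -/
lemma sum_deg_cycle_le [Fintype V] (hA : D.Crosses A) (hσ : D.IsCycleFactor σ)
    (hu : D.IsUnmergeable σ) (hcA : #A = a) (hcA' : #Aᶜ = a) (x : V) :
    ∑ v with σ.SameCycle x v, D.deg v ≤ 2 * halfLength A σ x * (a + halfLength A σ x) ∧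
      ((∃ w, (w ∈ A ↔ x ∈ A) ∧ ¬ D.Adj x (σ w) ∧ ¬ D.Adj w (σ x)) →
        ∑ v with σ.SameCycle x v, D.deg v < 2 * halfLength A σ x * (a + halfLength A σ x)) := by
  have hsum : ∑ v with σ.SameCycle x v, D.deg v
      = ∑ v with σ.SameCycle x v, (D.outDeg v + D.inDeg (σ v)) := by
    simp only [deg]
    rw [sum_add_distrib, sum_add_distrib]
    congr 1
    symm
    refine sum_equiv σ (fun v => ?_) (fun _ _ => rfl)
    simp [Equiv.Perm.sameCycle_apply_right]
  have hconst : ∑ v with σ.SameCycle x v, (a + halfLength A σ v)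
      = 2 * halfLength A σ x * (a + halfLength A σ x) := by
    rw [← card_cycle hA hσ x, ← smul_eq_mul, ← sum_const]
    refine sum_congr rfl fun v hv => ?_
    rw [mem_filter] at hv
    rw [halfLength_congr hv.2]
  rw [hsum, ← hconst]
  refine ⟨sum_le_sum fun v _ => (outDeg_add_inDeg_apply_le hA hσ hu hcA hcA' v).1, fun hw => ?_⟩
  exact sum_lt_sum (fun v _ => (outDeg_add_inDeg_apply_le hA hσ hu hcA hcA' v).1)
    ⟨x, by simp [Equiv.Perm.SameCycle.refl], (outDeg_add_inDeg_apply_le hA hσ hu hcA hcA' x).2 hw⟩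

/-- If all pairs of distinct elements of a set of at least two elements have `f`-sum at least `k`,
then the average of `f` is at least `k / 2`. -/
lemma card_mul_le_two_mul_sum {f : V → ℕ} {k : ℕ} {s : Finset V} (hs : 2 ≤ #s)
    (h : ∀ x ∈ s, ∀ y ∈ s, x ≠ y → k ≤ f x + f y) : #s * k ≤ 2 * ∑ x ∈ s, f x := by
  classical
  have h1 : ∑ p ∈ s.offDiag, k ≤ ∑ p ∈ s.offDiag, (f p.1 + f p.2) := by
    refine sum_le_sum fun p hp => ?_
    rw [mem_offDiag] at hp
    exact h _ hp.1 _ hp.2.1 hp.2.2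
  have h2 : ∑ p ∈ s.offDiag, (f p.1 + f p.2) + ∑ p ∈ s.diag, (f p.1 + f p.2)
      = ∑ p ∈ s ×ˢ s, (f p.1 + f p.2) := by
    rw [← diag_union_offDiag, sum_union (disjoint_diag_offDiag s), add_comm]
  rw [sum_product, sum_diag] at h2
  simp only [sum_add_distrib, sum_const, smul_eq_mul, offDiag_card, ← mul_sum] at h1 h2
  obtain ⟨n, hn⟩ := Nat.exists_eq_add_of_le hs
  rw [hn] at h1 h2 ⊢
  have h3 : (2 + n) * (2 + n) - (2 + n) = (n + 1) * (2 + n) := by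
    rw [show (2 + n) * (2 + n) = (n + 1) * (2 + n) + (2 + n) by ring, Nat.add_sub_cancel]
  rw [h3] at h1
  refine le_of_mul_le_mul_left ?_ (Nat.succ_pos n)
  nlinarith

open Classical in
/-- The degree condition gives a lower bound for the degree sum over any two cycles. -/
lemma le_sum_deg_two_cycles [Fintype V] (hA : D.Crosses A) (hσ : D.IsCycleFactor σ)
    (hM : D.MeynielCondition a (-1)) {x y : V} (hxy : ¬ σ.SameCycle x y) :
    (halfLength A σ x + halfLength A σ y) * (3 * a - 1) ≤
      ∑ v with σ.SameCycle x v, D.deg v + ∑ v with σ.SameCycle y v, D.deg v := by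
  have part : ∀ B : Finset V, D.Crosses B →
      (halfLength B σ x + halfLength B σ y) * (3 * a - 1) ≤
        2 * (∑ v ∈ B with σ.SameCycle x v, D.deg v + ∑ v ∈ B with σ.SameCycle y v, D.deg v) := by
    intro B hB
    have hdisj : Disjoint {v ∈ B | σ.SameCycle x v} {v ∈ B | σ.SameCycle y v} := by
      rw [disjoint_left]
      intro v hv hv'
      rw [mem_filter] at hv hv'
      exact hxy (hv.2.trans hv'.2.symm)
    have hx := halfLength_pos hB hσ x
    have hy := halfLength_pos hB hσ y
    unfold halfLength at hx hy ⊢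
    rw [← sum_union hdisj, ← card_union_of_disjoint hdisj]
    refine card_mul_le_two_mul_sum ?_ ?_
    · rw [card_union_of_disjoint hdisj]
      omega
    · intro u hu v hv huv
      have hu' : u ∈ B := by
        rw [mem_union, mem_filter, mem_filter] at hu; tauto
      have hv' : v ∈ B := by
        rw [mem_union, mem_filter, mem_filter] at hv; tauto
      have := hM u v huv (fun h => by have := hB u v h; tauto)
        (fun h => by have := hB v u h; tauto)
      omega
  have hA' : D.Crosses Aᶜ := by
    intro u v h
    have := hA u v h
    simp only [mem_compl]
    tauto
  have h1 := part A hA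
  have h2 := part Aᶜ hA'
  rw [halfLength_compl hA hσ, halfLength_compl hA hσ] at h2
  have split : ∀ z, ∑ v with σ.SameCycle z v, D.deg v
      = ∑ v ∈ A with σ.SameCycle z v, D.deg v + ∑ v ∈ Aᶜ with σ.SameCycle z v, D.deg v := by
    intro z
    rw [← sum_union]
    · congr 1
      ext v
      simp only [mem_union, mem_filter, mem_univ, mem_compl, true_and]
      tauto
    · rw [disjoint_left]
      simp only [mem_filter, mem_compl]
      tauto
  rw [split x, split y]
  omega

/-! ### Cycle factors with at least three cycles -/

/-- The degree sums over pairs of cycles leave only one possibility for three half-lengths. -/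
lemma eq_three_of_half_lengths {c₁ c₂ c₃ : ℕ} (h₁ : 0 < c₁) (h₂ : 0 < c₂) (h₃ : 0 < c₃)
    (hsum : c₁ + c₂ + c₃ ≤ a)
    (h₁₂ : (c₁ + c₂) * (3 * a - 1) ≤ 2 * c₁ * (a + c₁) + 2 * c₂ * (a + c₂))
    (h₁₃ : (c₁ + c₃) * (3 * a - 1) ≤ 2 * c₁ * (a + c₁) + 2 * c₃ * (a + c₃))
    (h₂₃ : (c₂ + c₃) * (3 * a - 1) ≤ 2 * c₂ * (a + c₂) + 2 * c₃ * (a + c₃)) :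
    a = 3 ∧ c₁ = 1 ∧ c₂ = 1 ∧ c₃ = 1 := by
  -- It suffices to use the two smallest of the three numbers.
  have key : ∀ x y z : ℕ, 0 < x → x ≤ y → y ≤ z → x + y + z ≤ a →
      (x + y) * (3 * a - 1) ≤ 2 * x * (a + x) + 2 * y * (a + y) →
      a = 3 ∧ x = 1 ∧ y = 1 ∧ z = 1 := by
    intro x y z hx hxy hyz hs h
    have e : ((3 * a - 1 : ℕ) : ℤ) = 3 * a - 1 := by omega
    zify at h
    rw [e] at h
    have hx' : (1 : ℤ) ≤ x := by exact_mod_cast hx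
    have hxy' : (x : ℤ) ≤ y := by exact_mod_cast hxy
    have hs' : (x : ℤ) + 2 * y ≤ a := by exact_mod_cast (by omega : x + 2 * y ≤ a)
    -- The inequality reads `p₁ + p₂ + p₃ + p₄ ≤ 0` with four nonnegative products.
    have p₁ : 0 ≤ (x : ℤ) * (y - x) := mul_nonneg (by linarith) (by linarith)
    have p₂ : 0 ≤ (x : ℤ) * (y - 1) := mul_nonneg (by linarith) (by linarith)
    have p₃ : 0 ≤ (y : ℤ) * (x - 1) := mul_nonneg (by linarith) (by linarith)
    have p₄ : 0 ≤ ((x : ℤ) + y) * (a - x - 2 * y) := mul_nonneg (by linarith) (by linarith)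
    have z₂ : (x : ℤ) * (y - 1) = 0 := by linarith
    have z₄ : ((x : ℤ) + y) * (a - x - 2 * y) = 0 := by linarith
    have hy : (y : ℤ) - 1 = 0 := (mul_eq_zero.1 z₂).resolve_left (by linarith)
    have ha : (a : ℤ) - x - 2 * y = 0 := (mul_eq_zero.1 z₄).resolve_left (by linarith)
    omega
  rcases le_total c₁ c₂ with h | h <;> rcases le_total c₂ c₃ with h' | h' <;>
    rcases le_total c₁ c₃ with h'' | h''
  · have := key c₁ c₂ c₃ h₁ h h' (by omega) (by linarith); tauto
  · have := key c₁ c₂ c₃ h₁ h h' (by omega) (by linarith); tauto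
  · have := key c₁ c₃ c₂ h₁ h'' h' (by omega) (by linarith); tauto
  · have := key c₃ c₁ c₂ h₃ h'' h (by omega) (by linarith); tauto
  · have := key c₂ c₁ c₃ h₂ h h'' (by omega) (by linarith); tauto
  · have := key c₂ c₃ c₁ h₂ h' h'' (by omega) (by linarith); tauto
  · have := key c₃ c₂ c₁ h₃ h' h (by omega) (by linarith); tauto
  · have := key c₃ c₂ c₁ h₃ h' h (by omega) (by linarith); tauto

/-- Three cycles of length two covering the vertex set are strung together into the path
`σ p → p → σ q → q → σ r → r`. -/
lemma isTraceable_of_three_two_cycles [Fintype V] (hA : D.Crosses A) (hσ : D.IsCycleFactor σ)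
    (hcard : Fintype.card V = 6) {p q r : V} (hp : p ∈ A) (hq : q ∈ A) (hr : r ∈ A)
    (hpq : p ≠ q) (hpr : p ≠ r) (hqr : q ≠ r) (hσp : σ (σ p) = p) (hσq : σ (σ q) = q)
    (hσr : σ (σ r) = r) (h₁ : D.Adj p (σ q)) (h₂ : D.Adj q (σ r)) : D.IsTraceable := by
  classical
  have hp' : σ p ∉ A := by rw [hA.apply_mem_iff hσ]; simpa
  have hq' : σ q ∉ A := by rw [hA.apply_mem_iff hσ]; simpa
  have hr' : σ r ∉ A := by rw [hA.apply_mem_iff hσ]; simpa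
  have ne : ∀ {x y : V}, x ∈ A → y ∉ A → x ≠ y := fun hx hy h => hy (h ▸ hx)
  have hnodup : [σ p, p, σ q, q, σ r, r].Nodup := by
    simp [hpq, hpr, hqr, ne hp hq', ne hp hr', ne hq hr', (ne hp hp').symm, (ne hq hp').symm,
      (ne hr hp').symm, (ne hq hq').symm, (ne hr hq').symm, (ne hr hr').symm]
  refine ⟨_, ?_, hnodup, fun v => ?_⟩
  · have a₁ := hσ (σ p)
    have a₂ := hσ (σ q)
    have a₃ := hσ (σ r)
    rw [hσp] at a₁
    rw [hσq] at a₂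
    rw [hσr] at a₃
    simp [a₁, a₂, a₃, h₁, h₂]
  · have : [σ p, p, σ q, q, σ r, r].toFinset = univ := by
      rw [← card_eq_iff_eq_univ, List.toFinset_card_of_nodup hnodup, hcard]
      rfl
    rw [← List.mem_toFinset, this]
    exact mem_univ v

lemma IsCycleFactor.apply_apply_of_halfLength_eq_one [Fintype V] (hA : D.Crosses A)
    (hσ : D.IsCycleFactor σ) {x : V} (hx : x ∈ A) (h : halfLength A σ x = 1) : σ (σ x) = x := by
  classical
  have hmem : σ (σ x) ∈ A := by
    rw [hA.apply_mem_iff hσ, hA.apply_mem_iff hσ]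
    simpa
  exact card_le_one.1 h.le _
    (mem_filter.2 ⟨hmem, by simp [Equiv.Perm.sameCycle_apply_right, Equiv.Perm.SameCycle.refl]⟩) _
    (mem_filter.2 ⟨hx, Equiv.Perm.SameCycle.refl _ _⟩)

open Classical in
/-- With three or more cycles, the degree sums force three cycles of length two and all the
corresponding inequalities to be tight, so that `x → σ y` or `y → σ x` for all `x ≠ y` in `A`:
a tournament on three vertices, which has a hamiltonian path. -/
lemma IsCycleFactor.isTraceable [Fintype V] (hA : D.Crosses A) (hcA : #A = a)
    (hcA' : #Aᶜ = a) (hD : D.IsStrong) (hM : D.MeynielCondition a (-1)) (hσ : D.IsCycleFactor σ)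
    (hu : D.IsUnmergeable σ) (ha : 0 < a) : D.IsTraceable := by
  have rep : ∀ v, ∃ w ∈ A, σ.SameCycle w v := by
    intro v
    by_cases hv : v ∈ A
    · exact ⟨v, hv, Equiv.Perm.SameCycle.refl _ _⟩
    · exact ⟨σ v, (hA.apply_mem_iff hσ v).2 hv,
        Equiv.Perm.sameCycle_apply_left.2 (Equiv.Perm.SameCycle.refl _ _)⟩
  have hA0 : A.Nonempty := by
    rw [← card_pos]; omega
  obtain ⟨x, hx⟩ := hA0
  by_cases htwo : ∃ y, ∀ z, σ.SameCycle x z ∨ σ.SameCycle y z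
  · obtain ⟨y, hy⟩ := htwo
    exact hσ.isTraceable_of_le_two hA hD hy
  push Not at htwo
  obtain ⟨y, hy, hxy⟩ : ∃ y ∈ A, ¬ σ.SameCycle x y := by
    obtain ⟨y, hy, -⟩ := htwo x
    obtain ⟨w, hw, hwy⟩ := rep y
    exact ⟨w, hw, fun h => hy (h.trans hwy)⟩
  obtain ⟨z, hz, hxz, hyz⟩ : ∃ z ∈ A, ¬ σ.SameCycle x z ∧ ¬ σ.SameCycle y z := by
    obtain ⟨z, hz, hz'⟩ := htwo y
    obtain ⟨w, hw, hwz⟩ := rep z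
    exact ⟨w, hw, fun h => hz (h.trans hwz), fun h => hz' (h.trans hwz)⟩
  have pair : ∀ {u v : V}, ¬ σ.SameCycle u v →
      (halfLength A σ u + halfLength A σ v) * (3 * a - 1) ≤
        2 * halfLength A σ u * (a + halfLength A σ u) +
          2 * halfLength A σ v * (a + halfLength A σ v) := fun huv =>
    (le_sum_deg_two_cycles hA hσ hM huv).trans
      (Nat.add_le_add (sum_deg_cycle_le hA hσ hu hcA hcA' _).1
        (sum_deg_cycle_le hA hσ hu hcA hcA' _).1)
  have hsum : halfLength A σ x + halfLength A σ y + halfLength A σ z ≤ a := by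
    unfold halfLength
    rw [← hcA, ← card_union_of_disjoint, ← card_union_of_disjoint]
    · refine card_le_card ?_
      intro v
      simp only [mem_union, mem_filter]
      tauto
    · rw [disjoint_left]
      simp only [mem_union, mem_filter]
      rintro v (hv | hv) hv'
      · exact hxz (hv.2.trans hv'.2.symm)
      · exact hyz (hv.2.trans hv'.2.symm)
    · rw [disjoint_left]
      simp only [mem_filter]
      exact fun v hv hv' => hxy (hv.2.trans hv'.2.symm)
  obtain ⟨rfl, cx, cy, cz⟩ := eq_three_of_half_lengths (halfLength_pos hA hσ x)
    (halfLength_pos hA hσ y) (halfLength_pos hA hσ z) hsum (pair hxy) (pair hxz) (pair hyz)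
  have tournament : ∀ {u v : V}, u ∈ A → v ∈ A → halfLength A σ u = 1 → halfLength A σ v = 1 →
      ¬ σ.SameCycle u v → D.Adj u (σ v) ∨ D.Adj v (σ u) := by
    intro u v hu' hv' cu cv huv
    by_contra! hcon
    have l := le_sum_deg_two_cycles hA hσ hM huv
    have lu := (sum_deg_cycle_le hA hσ hu hcA hcA' u).2 ⟨v, by tauto, hcon⟩
    have lv := (sum_deg_cycle_le hA hσ hu hcA hcA' v).1
    rw [cu] at l lu
    rw [cv] at l lv
    omega
  have hcard : Fintype.card V = 6 := by
    rw [← card_add_card_compl A]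
    omega
  have ne : ∀ {u v : V}, ¬ σ.SameCycle u v → u ≠ v := fun h e =>
    h (e ▸ Equiv.Perm.SameCycle.refl _ _)
  have sx := hσ.apply_apply_of_halfLength_eq_one hA hx cx
  have sy := hσ.apply_apply_of_halfLength_eq_one hA hy cy
  have sz := hσ.apply_apply_of_halfLength_eq_one hA hz cz
  have nxy := ne hxy
  have nxz := ne hxz
  have nyz := ne hyz
  have path := @isTraceable_of_three_two_cycles V D A σ _ hA hσ hcard
  rcases tournament hx hy cx cy hxy with h | h <;>
    rcases tournament hy hz cy cz hyz with h' | h' <;>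
    rcases tournament hx hz cx cz hxz with h'' | h''
  · exact path hx hy hz nxy nxz nyz sx sy sz h h'
  · exact path hx hy hz nxy nxz nyz sx sy sz h h'
  · exact path hx hz hy nxz nxy nyz.symm sx sz sy h'' h'
  · exact path hz hx hy nxz.symm nyz.symm nxy sz sx sy h'' h
  · exact path hy hx hz nxy.symm nyz nxz sy sx sz h h''
  · exact path hy hz hx nyz nxy.symm nxz.symm sy sz sx h' h''
  · exact path hz hy hx nyz.symm nxz.symm nxy.symm sz sy sx h' h
  · exact path hz hy hx nyz.symm nxz.symm nxy.symm sz sy sx h' h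

/-! ### Digraphs without a cycle factor -/

/-- If all arcs in both directions between `X` and `Y` are present and `X` has one vertex more
than `Y`, then `X ∪ Y` is covered by an alternating path that starts and ends in `X`. -/
lemma exists_alternating_path {X Y : Finset V} (hXY : Disjoint X Y)
    (hcard : #X = #Y + 1) (h : ∀ x ∈ X, ∀ y ∈ Y, D.Adj x y ∧ D.Adj y x) :
    ∃ l : List V, l.IsChain D.Adj ∧ l.Nodup ∧ (∀ v, v ∈ l ↔ v ∈ X ∨ v ∈ Y) ∧
      (∀ v ∈ l.head?, v ∈ X) ∧ ∀ v ∈ l.getLast?, v ∈ X := by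
  classical
  induction hn : #Y generalizing X Y with
  | zero =>
    rw [hn] at hcard
    obtain ⟨x, rfl⟩ := card_eq_one.1 hcard
    rw [card_eq_zero] at hn
    exact ⟨[x], by simp, by simp, by simp [hn], by simp, by simp⟩
  | succ n ih =>
    obtain ⟨y, hy⟩ : Y.Nonempty := by rw [← card_pos]; omega
    obtain ⟨x, hx⟩ : X.Nonempty := by rw [← card_pos]; omega
    have cX := card_erase_of_mem hx
    have cY := card_erase_of_mem hy
    obtain ⟨l, hl, hnd, hmem, hhead, hlast⟩ := @ih (X.erase x) (Y.erase y)
      (hXY.mono (erase_subset _ _) (erase_subset _ _)) (by omega)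
      (fun u hu v hv => h u (mem_of_mem_erase hu) v (mem_of_mem_erase hv)) (by omega)
    have hxY : x ∉ Y := disjoint_left.1 hXY hx
    have hyX : y ∉ X := disjoint_right.1 hXY hy
    have hl0 : l ≠ [] := by
      rintro rfl
      obtain ⟨u, hu⟩ : (X.erase x).Nonempty := by rw [← card_pos]; omega
      simpa using (hmem u).2 (Or.inl hu)
    refine ⟨x :: y :: l, ?_, ?_, ?_, ?_, ?_⟩
    · rw [List.isChain_cons_cons, List.isChain_cons]
      exact ⟨(h x hx y hy).1, fun v hv => (h v (mem_of_mem_erase (hhead v hv)) y hy).2, hl⟩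
    · rw [List.nodup_cons, List.nodup_cons, List.mem_cons, hmem, hmem]
      refine ⟨?_, ?_, hnd⟩
      · rintro (e | e | e)
        · exact hxY (e ▸ hy)
        · exact notMem_erase _ _ e
        · exact hxY (mem_of_mem_erase e)
      · rintro (e | e)
        · exact hyX (mem_of_mem_erase e)
        · exact notMem_erase _ _ e
    · intro v
      rw [List.mem_cons, List.mem_cons, hmem, mem_erase, mem_erase]
      by_cases h1 : v = x
      · simp [h1, hx]
      · by_cases h2 : v = y
        · simp [h2, hy]
        · simp [h1, h2]
    · simpa using hx
    · intro v hv
      obtain ⟨b, l', rfl⟩ := List.exists_cons_of_ne_nil hl0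
      rw [List.getLast?_cons_cons, List.getLast?_cons_cons] at hv
      exact mem_of_mem_erase (hlast v hv)

lemma IsStrong.exists_adj_from (hD : D.IsStrong) {x y : V} (h : x ≠ y) : ∃ z, D.Adj x z := by
  rcases (hD x y).cases_head with e | ⟨z, hz, -⟩
  · exact absurd e h
  · exact ⟨z, hz⟩

lemma IsStrong.exists_adj_to (hD : D.IsStrong) {x y : V} (h : x ≠ y) : ∃ z, D.Adj z y := by
  rcases (hD x y).cases_tail with e | ⟨z, -, hz⟩
  · exact absurd e.symm h
  · exact ⟨z, hz⟩

open Classical in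
/-- Let `S ⊆ A` violate Hall's condition, let `N` be its out-neighbourhood and let `T` be the rest
of the other part, so that no arc leads from `S` to `T`.  The degree condition in `S` and in `T`
forces `#S = #N + 1` and `#T = #(A \ S) + 1`, and all arcs between `S` and `N`, between `T` and
`A \ S`, and from `T` to `S` to be present.  An alternating path through `T ∪ (A \ S)` followed by
one through `S ∪ N` is hamiltonian. -/
lemma isTraceable_of_hall_violator [Fintype V] (hA : D.Crosses A) (hcA : #A = a)
    (hcA' : #Aᶜ = a) (hD : D.IsStrong) (hM : D.MeynielCondition a (-1)) (ha : 2 ≤ a)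
    {S : Finset V} (hS : S ⊆ A) (hlt : #{v | ∃ s ∈ S, D.Adj s v} < #S) : D.IsTraceable := by
  set N : Finset V := ({v | ∃ s ∈ S, D.Adj s v} : Finset V) with hN
  have memN : ∀ v, v ∈ N ↔ ∃ s ∈ S, D.Adj s v := by simp [hN]
  have hNA : N ⊆ Aᶜ := by
    intro v hv
    obtain ⟨s, hs, hsv⟩ := (memN v).1 hv
    rw [mem_compl]
    exact (hA s v hsv).1 (hS hs)
  set T := Aᶜ \ N with hT
  set R := A \ S with hR
  have cT : #T = a - #N := by rw [hT, card_sdiff_of_subset hNA, hcA']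
  have cR : #R = a - #S := by rw [hR, card_sdiff_of_subset hS, hcA]
  have cS : #S ≤ a := hcA ▸ card_le_card hS
  have outS : ∀ s ∈ S, ({v | D.Adj s v} : Finset V) ⊆ N := fun s hs v hv =>
    (memN v).2 ⟨s, hs, by simpa using hv⟩
  have inS : ∀ s ∈ S, ({v | D.Adj v s} : Finset V) ⊆ Aᶜ := by
    intro s hs v hv
    have := hA v s (by simpa using hv)
    have := hS hs
    rw [mem_compl]; tauto
  have outT : ∀ t ∈ T, ({v | D.Adj t v} : Finset V) ⊆ A := by
    intro t ht v hv
    have := hA t v (by simpa using hv)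
    rw [hT, mem_sdiff, mem_compl] at ht
    tauto
  have inT : ∀ t ∈ T, ({v | D.Adj v t} : Finset V) ⊆ R := by
    intro t ht v hv
    have hv' : D.Adj v t := by simpa using hv
    have := hA v t hv'
    rw [hT, mem_sdiff, mem_compl, memN] at ht
    rw [hR, mem_sdiff]
    exact ⟨by tauto, fun hvS => ht.2 ⟨v, hvS, hv'⟩⟩
  have hother : ∀ x : V, ∃ y, x ≠ y := by
    intro x
    obtain ⟨y, -, hy⟩ := exists_mem_ne (s := A) (by omega) x
    exact ⟨y, hy.symm⟩
  have hN0 : 0 < #N := by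
    obtain ⟨s, hs⟩ : S.Nonempty := by rw [← card_pos]; omega
    obtain ⟨y, hy⟩ := hother s
    obtain ⟨z, hz⟩ := hD.exists_adj_from hy
    exact card_pos.2 ⟨z, (memN z).2 ⟨s, hs, hz⟩⟩
  have hR0 : 0 < #R := by
    obtain ⟨t, ht⟩ : T.Nonempty := by rw [← card_pos]; omega
    obtain ⟨y, hy⟩ := hother t
    obtain ⟨z, hz⟩ := hD.exists_adj_to hy.symm
    exact card_pos.2 ⟨z, inT t ht (by simpa using hz)⟩
  have degS : ∀ s ∈ S, D.outDeg s ≤ #N ∧ D.inDeg s ≤ a := by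
    intro s hs
    rw [outDeg_eq_card, inDeg_eq_card]
    exact ⟨card_le_card (outS s hs), hcA' ▸ card_le_card (inS s hs)⟩
  have degT : ∀ t ∈ T, D.outDeg t ≤ a ∧ D.inDeg t ≤ #R := by
    intro t ht
    rw [outDeg_eq_card, inDeg_eq_card]
    exact ⟨hcA ▸ card_le_card (outT t ht), card_le_card (inT t ht)⟩
  have sumS : ∀ s ∈ S, ∀ s' ∈ S, s ≠ s' → 3 * a ≤ D.deg s + D.deg s' + 1 := by
    intro s hs s' hs' hne
    have h1 := hS hs
    have h2 := hS hs'
    have := hM s s' hne (fun h => by have := hA _ _ h; tauto) (fun h => by have := hA _ _ h; tauto)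
    omega
  have sumT : ∀ t ∈ T, ∀ t' ∈ T, t ≠ t' → 3 * a ≤ D.deg t + D.deg t' + 1 := by
    intro t ht t' ht' hne
    rw [hT, mem_sdiff, mem_compl] at ht ht'
    have := hM t t' hne (fun h => by have := hA _ _ h; tauto) (fun h => by have := hA _ _ h; tauto)
    omega
  unfold deg at sumS sumT
  obtain ⟨hSN, hSa⟩ : #S = #N + 1 ∧ a + 1 = 2 * #S := by
    obtain ⟨s, hs, s', hs', hne⟩ := one_lt_card.1 (by omega : 1 < #S)
    obtain ⟨t, ht, t', ht', hne'⟩ := one_lt_card.1 (by omega : 1 < #T)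
    have := sumS s hs s' hs' hne
    have := sumT t ht t' ht' hne'
    have := degS s hs
    have := degS s' hs'
    have := degT t ht
    have := degT t' ht'
    omega
  have fullS : ∀ s ∈ S, (∀ v ∈ N, D.Adj s v) ∧ ∀ v ∈ Aᶜ, D.Adj v s := by
    intro s hs
    obtain ⟨s', hs', hne⟩ := exists_mem_ne (by omega : 1 < #S) s
    have h1 := sumS s hs s' hs' hne.symm
    have h2 := degS s hs
    have h3 := degS s' hs'
    have h4 : #N ≤ D.outDeg s := by omega
    have h5 : #Aᶜ ≤ D.inDeg s := by omega
    rw [outDeg_eq_card] at h4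
    rw [inDeg_eq_card] at h5
    have e4 := eq_of_subset_of_card_le (outS s hs) h4
    have e5 := eq_of_subset_of_card_le (inS s hs) h5
    refine ⟨fun v hv => ?_, fun v hv => ?_⟩
    · rw [← e4] at hv; simpa using hv
    · rw [← e5] at hv; simpa using hv
  have fullT : ∀ t ∈ T, (∀ v ∈ A, D.Adj t v) ∧ ∀ v ∈ R, D.Adj v t := by
    intro t ht
    obtain ⟨t', ht', hne⟩ := exists_mem_ne (by omega : 1 < #T) t
    have h1 := sumT t ht t' ht' hne.symm
    have h2 := degT t ht
    have h3 := degT t' ht'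
    have h4 : #A ≤ D.outDeg t := by omega
    have h5 : #R ≤ D.inDeg t := by omega
    rw [outDeg_eq_card] at h4
    rw [inDeg_eq_card] at h5
    have e4 := eq_of_subset_of_card_le (outT t ht) h4
    have e5 := eq_of_subset_of_card_le (inT t ht) h5
    refine ⟨fun v hv => ?_, fun v hv => ?_⟩
    · rw [← e4] at hv; simpa using hv
    · rw [← e5] at hv; simpa using hv
  have hTA : T ⊆ Aᶜ := sdiff_subset
  have hRA : R ⊆ A := sdiff_subset
  have hdisj : Disjoint Aᶜ A := disjoint_compl_left
  obtain ⟨l, hl, lnd, lmem, -, llast⟩ := exists_alternating_path (D := D) (X := T) (Y := R)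
    (hdisj.mono hTA hRA) (by omega)
    (fun t ht r hr => ⟨(fullT t ht).1 r (hRA hr), (fullT t ht).2 r hr⟩)
  obtain ⟨m, hm, mnd, mmem, mhead, -⟩ := exists_alternating_path (D := D) (X := S) (Y := N)
    (hdisj.symm.mono hS hNA) hSN
    (fun s hs v hv => ⟨(fullS s hs).1 v hv, (fullS s hs).2 v (hNA hv)⟩)
  refine ⟨l ++ m, ?_, ?_, fun v => ?_⟩
  · rw [List.isChain_append]
    exact ⟨hl, hm, fun t ht s hs => (fullT t (llast t ht)).1 s (hS (mhead s hs))⟩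
  · refine List.Nodup.append lnd mnd fun v hv hv' => ?_
    rw [lmem, hT, hR, mem_sdiff, mem_sdiff, mem_compl] at hv
    rw [mmem] at hv'
    have h1 : v ∈ N → v ∉ A := fun h => by simpa using hNA h
    have h2 := @hS v
    tauto
  · rw [List.mem_append, lmem, mmem, hT, hR, mem_sdiff, mem_sdiff, mem_compl]
    tauto

/-- By Hall's theorem, applied to the arcs from all of `V` to all of `V`, there is either a cycle
factor or a violator of Hall's condition, which may be taken inside one of the parts. -/
lemma isTraceable_of_meynielCondition [Finite V] (ha : 3 ≤ a) (hB : D.IsBalancedBipartite a)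
    (hD : D.IsStrong) (hM : D.MeynielCondition a (-1)) : D.IsTraceable := by
  classical
  let := Fintype.ofFinite V
  obtain ⟨V₁, V₂, hdisj, hunion, h₁, h₂, c₁, c₂⟩ := hB
  obtain ⟨A, rfl⟩ : ∃ A : Finset V, (A : Set V) = V₁ := ⟨V₁.toFinset, by simp⟩
  have hV₂ : V₂ = ((Aᶜ : Finset V) : Set V) := by
    rw [coe_compl]
    exact (IsCompl.of_eq hdisj.eq_bot hunion).compl_eq.symm
  subst hV₂
  rw [Set.ncard_coe_finset] at c₁ c₂
  have hA : D.Crosses A := by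
    intro x y h
    have n₁ := fun hx hy => h₁ x hx y hy h
    have n₂ := fun hx hy => h₂ x hx y hy h
    simp only [mem_coe, mem_compl] at n₁ n₂
    tauto
  have hA' : D.Crosses Aᶜ := by
    intro x y h
    have := hA x y h
    simp only [mem_compl]
    tauto
  by_cases hall : ∀ S : Finset V, #S ≤ #{v | ∃ s ∈ S, D.Adj s v}
  · obtain ⟨f, hf, hadj⟩ := (Fintype.all_card_le_filter_rel_iff_exists_injective D.Adj).1 hall
    have hσ : D.IsCycleFactor (Equiv.ofBijective f (Finite.injective_iff_bijective.1 hf)) := hadj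
    obtain ⟨τ, hτ, hu⟩ := hσ.exists_isUnmergeable
    exact hτ.isTraceable hA c₁ c₂ hD hM hu (by omega)
  · push Not at hall
    obtain ⟨S, hS⟩ := hall
    by_cases hSA : #{v | ∃ s ∈ S ∩ A, D.Adj s v} < #(S ∩ A)
    · exact isTraceable_of_hall_violator hA c₁ c₂ hD hM (by omega) inter_subset_right hSA
    · refine isTraceable_of_hall_violator hA' c₂ (by rwa [compl_compl]) hD hM (by omega)
        (S := S ∩ Aᶜ) inter_subset_right ?_
      have e₁ : #(S ∩ A) + #(S ∩ Aᶜ) = #S := by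
        rw [← card_union_of_disjoint, ← inter_union_distrib_left, union_compl, inter_univ]
        exact disjoint_compl_right.mono inter_subset_right inter_subset_right
      have e₂ : #{v | ∃ s ∈ S ∩ A, D.Adj s v} + #{v | ∃ s ∈ S ∩ Aᶜ, D.Adj s v}
          ≤ #{v | ∃ s ∈ S, D.Adj s v} := by
        rw [← card_union_of_disjoint]
        · refine card_le_card fun v => ?_
          simp only [mem_union, mem_filter, mem_univ, true_and, mem_inter]
          rintro (⟨s, hs, h⟩ | ⟨s, hs, h⟩) <;> exact ⟨s, hs.1, h⟩
        · rw [disjoint_left]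
          simp only [mem_filter, mem_univ, true_and, mem_inter, mem_compl]
          rintro v ⟨s, hs, h⟩ ⟨s', hs', h'⟩
          have := hA _ _ h
          have := hA _ _ h'
          tauto
      omega

/-! ### The digraph `H₃` -/

lemma ncard_union_range {ι κ α : Type*} [Finite ι] [Finite κ] {f : ι → α} {g : κ → α}
    (hf : f.Injective) (hg : g.Injective) (h : ∀ i j, f i ≠ g j) :
    (Set.range f ∪ Set.range g).ncard = Nat.card ι + Nat.card κ := by
  rw [Set.ncard_union_eq _ (Set.finite_range f) (Set.finite_range g),
    Set.ncard_range_of_injective hf, Set.ncard_range_of_injective hg]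
  rw [Set.disjoint_left]
  rintro _ ⟨i, rfl⟩ ⟨j, hj⟩
  exact h i j hj.symm

instance : Finite (H3Vertex a) := by
  refine Finite.of_surjective (α := (Fin ((a + 2) / 2) ⊕ Fin ((a - 2) / 2)) ⊕
    (Fin ((a - 2) / 2) ⊕ Fin ((a + 2) / 2)))
    (Sum.elim (Sum.elim .S .R) (Sum.elim .U .W)) ?_
  rintro (i | i | i | i)
  · exact ⟨.inl (.inl i), rfl⟩
  · exact ⟨.inl (.inr i), rfl⟩
  · exact ⟨.inr (.inl i), rfl⟩
  · exact ⟨.inr (.inr i), rfl⟩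

lemma H3_isBalancedBipartite (ha : 4 ≤ a) (he : Even a) : (H3 a).IsBalancedBipartite a := by
  obtain ⟨m, rfl⟩ := he
  refine ⟨Set.range .S ∪ Set.range .R, Set.range .U ∪ Set.range .W, ?_, ?_, ?_, ?_, ?_, ?_⟩
  · rw [Set.disjoint_left]
    rintro _ (⟨i, rfl⟩ | ⟨i, rfl⟩) (⟨j, hj⟩ | ⟨j, hj⟩) <;> cases hj
  · rw [Set.eq_univ_iff_forall]
    rintro (i | i | i | i) <;> simp
  · rintro _ (⟨i, rfl⟩ | ⟨i, rfl⟩) _ (⟨j, rfl⟩ | ⟨j, rfl⟩) h <;> cases h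
  · rintro _ (⟨i, rfl⟩ | ⟨i, rfl⟩) _ (⟨j, rfl⟩ | ⟨j, rfl⟩) h <;> cases h
  · rw [ncard_union_range (fun _ _ h => by cases h; rfl) (fun _ _ h => by cases h; rfl)
      (fun _ _ h => by cases h), Nat.card_fin, Nat.card_fin]
    omega
  · rw [ncard_union_range (fun _ _ h => by cases h; rfl) (fun _ _ h => by cases h; rfl)
      (fun _ _ h => by cases h), Nat.card_fin, Nat.card_fin]
    omega

lemma H3_isStrong (ha : 4 ≤ a) : (H3 a).IsStrong := by
  let r₀ : Fin ((a - 2) / 2) := ⟨0, by omega⟩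
  have adj : ∀ {x y}, H3Arc a x y → Relation.ReflTransGen (H3 a).Adj x y := fun h => .single h
  have hto : ∀ x, Relation.ReflTransGen (H3 a).Adj x (.R r₀) := by
    rintro (i | i | i | i)
    · exact (adj (.su r₀ i)).trans (adj (.ur r₀ r₀))
    · exact (adj (.ru i r₀)).trans (adj (.ur r₀ r₀))
    · exact adj (.ur r₀ i)
    · exact adj (.wr r₀ i)
  have hfrom : ∀ x, Relation.ReflTransGen (H3 a).Adj (.R r₀) x := by
    rintro (i | i | i | i)
    · exact (adj (.ru r₀ r₀)).trans (adj (.us r₀ i))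
    · exact (adj (.ru r₀ r₀)).trans (adj (.ur i r₀))
    · exact adj (.ru r₀ i)
    · exact adj (.rw r₀ i)
  exact fun x y => (hto x).trans (hfrom y)

/-- All degrees of `H₃` are at least `(3a - 2) / 2`, with equality on `S` and on `W`. -/
lemma H3_le_deg (ha : 4 ≤ a) (he : Even a) (x : H3Vertex a) : 3 * a ≤ 2 * (H3 a).deg x + 2 := by
  obtain ⟨m, rfl⟩ := he
  have e₁ : (m + m + 2) / 2 = m + 1 := by omega
  have e₂ : (m + m - 2) / 2 = m - 1 := by omega
  have iS : (H3Vertex.S (a := m + m)).Injective := fun _ _ h => by cases h; rfl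
  have iR : (H3Vertex.R (a := m + m)).Injective := fun _ _ h => by cases h; rfl
  have iU : (H3Vertex.U (a := m + m)).Injective := fun _ _ h => by cases h; rfl
  have iW : (H3Vertex.W (a := m + m)).Injective := fun _ _ h => by cases h; rfl
  have cUW := ncard_union_range iU iW (fun _ _ h => by cases h)
  have cSR := ncard_union_range iS iR (fun _ _ h => by cases h)
  have cU := Set.ncard_range_of_injective iU
  have cR := Set.ncard_range_of_injective iR
  rw [Nat.card_fin, Nat.card_fin] at cUW cSR
  rw [Nat.card_fin] at cU cR
  have sub : ∀ {P Q : Set (H3Vertex (m + m))}, P ⊆ Q → P.ncard ≤ Q.ncard :=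
    fun h => Set.ncard_le_ncard h (Set.toFinite _)
  unfold deg outDeg inDeg
  rcases x with i | i | i | i
  · have h₁ : _ ≤ {u | (H3 (m + m)).Adj (.S i) u}.ncard :=
      sub (P := Set.range .U) (by rintro _ ⟨j, rfl⟩; exact .su _ _)
    have h₂ : _ ≤ {u | (H3 (m + m)).Adj u (.S i)}.ncard :=
      sub (P := Set.range .U ∪ Set.range .W)
        (by rintro _ (⟨j, rfl⟩ | ⟨j, rfl⟩); exacts [.us _ _, .ws _ _])
    omega
  · have h₁ : _ ≤ {u | (H3 (m + m)).Adj (.R i) u}.ncard :=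
      sub (P := Set.range .U ∪ Set.range .W)
        (by rintro _ (⟨j, rfl⟩ | ⟨j, rfl⟩); exacts [.ru _ _, .rw _ _])
    have h₂ : _ ≤ {u | (H3 (m + m)).Adj u (.R i)}.ncard :=
      sub (P := Set.range .U ∪ Set.range .W)
        (by rintro _ (⟨j, rfl⟩ | ⟨j, rfl⟩); exacts [.ur _ _, .wr _ _])
    omega
  · have h₁ : _ ≤ {u | (H3 (m + m)).Adj (.U i) u}.ncard :=
      sub (P := Set.range .S ∪ Set.range .R)
        (by rintro _ (⟨j, rfl⟩ | ⟨j, rfl⟩); exacts [.us _ _, .ur _ _])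
    have h₂ : _ ≤ {u | (H3 (m + m)).Adj u (.U i)}.ncard :=
      sub (P := Set.range .S ∪ Set.range .R)
        (by rintro _ (⟨j, rfl⟩ | ⟨j, rfl⟩); exacts [.su _ _, .ru _ _])
    omega
  · have h₁ : _ ≤ {u | (H3 (m + m)).Adj (.W i) u}.ncard :=
      sub (P := Set.range .S ∪ Set.range .R)
        (by rintro _ (⟨j, rfl⟩ | ⟨j, rfl⟩); exacts [.ws _ _, .wr _ _])
    have h₂ : _ ≤ {u | (H3 (m + m)).Adj u (.W i)}.ncard :=
      sub (P := Set.range .R) (by rintro _ ⟨j, rfl⟩; exact .rw _ _)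
    omega

/-- On a hamiltonian path, every vertex of `S` but a final one is followed by a vertex of `U`.
This would embed `S` into `U` with one element added, but `S` has two elements more than `U`. -/
lemma H3_not_isTraceable (ha : 4 ≤ a) (he : Even a) : ¬ (H3 a).IsTraceable := by
  rintro ⟨p, hchain, hnodup, hmem⟩
  have hnext : ∀ i : Fin ((a + 2) / 2), ∃ k, ∃ o : Option (Fin ((a - 2) / 2)),
      p[k]? = some (.S i) ∧ p[k + 1]? = o.map .U := by
    intro i
    obtain ⟨k, hk, hki⟩ := List.getElem_of_mem (hmem (.S i))
    refine ⟨k, ?_⟩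
    by_cases hk' : k + 1 < p.length
    · have h := List.isChain_iff_getElem.1 hchain k hk'
      rw [hki] at h
      generalize hw : p[k + 1] = w at h
      cases h with
      | su u _ => exact ⟨some u, by simp [hk, hki], by simp [hk', hw]⟩
    · exact ⟨none, by simp [hk, hki], by simp [not_lt.1 hk']⟩
  choose k f hk hf using hnext
  have hinj : f.Injective := by
    intro i j hij
    have lt : ∀ i, k i < p.length := fun i => (List.getElem?_eq_some_iff.1 (hk i)).1
    -- Equal successors have equal positions, since the path repeats no vertex.
    have hkk : k i = k j := by
      have e := (hf i).trans ((congrArg _ hij).trans (hf j).symm)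
      by_cases hi : k i + 1 < p.length
      · have := (List.getElem?_inj hi hnodup).1 e
        omega
      · have hj : p[k j + 1]? = none := by
          rw [← e]
          exact List.getElem?_eq_none (not_lt.1 hi)
        have := List.getElem?_eq_none_iff.1 hj
        have := lt i
        have := lt j
        omega
    have e := hk i
    rw [hkk, hk j] at e
    cases e
    rfl
  have := Fintype.card_le_of_injective f hinj
  rw [Fintype.card_option, Fintype.card_fin, Fintype.card_fin] at this
  obtain ⟨m, rfl⟩ := he
  omega

end Digraph

theorem mainTheorem2 :
    (∀ (V : Type*) [Finite V] (D : Digraph V) (a : ℕ), 3 ≤ a →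
      D.IsBalancedBipartite a → D.IsStrong → D.MeynielCondition a (-1) → D.IsTraceable) ∧
    (∀ a : ℕ, 4 ≤ a → Even a →
      (Digraph.H3 a).IsBalancedBipartite a ∧ (Digraph.H3 a).IsStrong ∧
        (Digraph.H3 a).MeynielCondition a (-2) ∧ ¬ (Digraph.H3 a).IsTraceable) := by
  refine ⟨fun V _ D a ha hB hD hM => Digraph.isTraceable_of_meynielCondition ha hB hD hM,
    fun a ha he => ⟨Digraph.H3_isBalancedBipartite ha he, Digraph.H3_isStrong ha,
      fun u v _ _ _ => ?_, Digraph.H3_not_isTraceable ha he⟩⟩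
  have hu := Digraph.H3_le_deg ha he u
  have hv := Digraph.H3_le_deg ha he v
  omega
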